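/- Let $C_{\mathrm{GN}} = 3^{1/6}(2\pi)^{-1/9}$. This is the sharp constant in the Gagliardo–Nirenberg inequality on $\mathbb{R}$, i.e. the least constant $C$ such that $$\|f\|_{L^6(\mathbb{R})} \le C\, \|f'\|_{L^2(\mathbb{R})}^{1/9}\, \|f\|_{L^4(\mathbb{R})}^{8/9}$$ for all complex-valued $f \in H^1(\mathbb{R})$. Moreover, let $L > 0$ and $\delta > 0$, and let $\mathbb{T}_L = \mathbb{R}/L\mathbb{Z}$ carry Lebesgue measure (of total mass $L$). Then every complex-valued $f \in H^1(\mathbb{T}_L)$, with weak derivative $f'$, belongs to $L^4(\mathbb{T}_L) \cap L^6(\mathbb{T}_L)$ and satisfies $$\|f\|_{L^6(\mathbb{T}_L)} \le C_{\mathrm{GN}} \Big(1 + \frac{2\delta}{5L}\Big)^{2/9} \Big(\|f'\|_{L^2(\mathbb{T}_L)}^2 + \frac{2}{\delta L^{1/2}} \|f\|_{L^4(\mathbb{T}_L)}^2\Big)^{1/18} \|f\|_{L^4(\mathbb{T}_L)}^{8/9}.$$ -/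

import Mathlib

open MeasureTheory
open scoped ContDiff

namespace GNTorus

/-- `f` belongs to `H¹(ℝ)` (complex valued) and `g` is its weak derivative: both are square
integrable and `∫ f φ' = - ∫ g φ` for all smooth compactly supported test functions `φ`. -/
structure IsH1Line (f g : ℝ → ℂ) : Prop where
  memLp : MemLp f 2 volume
  memLp_deriv : MemLp g 2 volume
  weak_deriv : ∀ φ : ℝ → ℂ, ContDiff ℝ ∞ φ → HasCompactSupport φ →
    ∫ x, f x * deriv φ x = -∫ x, g x * φ x

/-- `f` belongs to `H¹(ℝ / L ℤ)` (complex valued) and `g` is its weak derivative: both are square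
integrable over one period and `∫ f φ' = - ∫ g φ` for all smooth test functions `φ` on `ℝ / L ℤ`.
The measure on `AddCircle L` is Lebesgue measure, of total mass `L`. The function `ψ` is `φ'`,
read on the circle. -/
structure IsH1Circle {L : ℝ} [Fact (0 < L)] (f g : AddCircle L → ℂ) : Prop where
  memLp : MemLp f 2 volume
  memLp_deriv : MemLp g 2 volume
  weak_deriv : ∀ φ ψ : AddCircle L → ℂ, ContDiff ℝ ∞ (fun x : ℝ => φ (x : AddCircle L)) →
    (∀ x : ℝ, HasDerivAt (fun y : ℝ => φ (y : AddCircle L)) (ψ (x : AddCircle L)) x) →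
    ∫ x, f x * ψ x = -∫ x, g x * φ x

/-- The constant `3^{1/6} (2π)^{-1/9}`. -/
noncomputable def CGN : ℝ := (3 : ℝ) ^ (1 / 6 : ℝ) * (2 * Real.pi) ^ (-(1 / 9) : ℝ)

/-- The constants `C` for which
`‖f‖_{L⁶(ℝ)} ≤ C ‖f'‖_{L²(ℝ)}^{1/9} ‖f‖_{L⁴(ℝ)}^{8/9}` holds for all `f ∈ H¹(ℝ)`. -/
def gagliardoNirenbergConstants : Set ℝ :=
  {C | ∀ f f' : ℝ → ℂ, IsH1Line f f' →
    MemLp f 4 volume ∧ MemLp f 6 volume ∧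
    lpNorm f 6 volume ≤
      C * lpNorm f' 2 volume ^ (1 / 9 : ℝ) * lpNorm f 4 volume ^ (8 / 9 : ℝ)}

end GNTorus

open Set Filter Topology

/-! Put `A = ∫|u'|²`, `B = ∫|u|⁴`, `G = ∫|u|⁶`, let `m` be the supremum of `|u|`, and let `H` be the
primitive of `w²√(m² - w²)` with `H(0) = 0`. Since `| |u|' | ≤ |u'|`, Young's inequality bounds `2l`
times the variation of `H(|u|)` by `A + l²(m²B - G)` for every `l ≥ 0` (`IsPrimitive.action_le`).

On the line `|u|` climbs from near `0` to near `m` and descends again, so the variation is at least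
`2H(m) = πm⁴/8`. Optimising over `l` leaves `π²m⁸ + 64AG ≤ 64Am²B`, and weighted AM-GM eliminates
`m`, giving `G³ ≤ 27/(4π²) A B⁴` (`pow_three_le_of_forall_energy`). This is the 18th power of the
claim. The profile `(1 + x²)^{-1/2}` satisfies `|u'|² = u⁴ - u⁶` and gives equality, so the constant
is least.

On the circle `|u|` descends only to its minimum `s`, and the two arcs give `4l(H(m) - H(s))`. The
missing `4l H(s)` is paid for by two linear ramps from `0` to `s` of length `δ`
(`two_mul_profileAction_le`). Their cost is absorbed into `A` and `B` through `L s⁴ ≤ B`, which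
produces the correction terms in `δ` and `L`.

Weak derivatives enter only through absolutely continuous representatives: du Bois-Reymond on the
line, Parseval on the circle. -/

/-- A function whose increments are dominated by those of an absolutely continuous function is
absolutely continuous. -/
theorem AbsolutelyContinuousOnInterval.of_dist_le {X Y : Type*} [PseudoMetricSpace X]
    [PseudoMetricSpace Y] {f : ℝ → X} {g : ℝ → Y} {a b K : ℝ}
    (hg : AbsolutelyContinuousOnInterval g a b)
    (h : ∀ x ∈ uIcc a b, ∀ y ∈ uIcc a b, dist (f x) (f y) ≤ K * dist (g x) (g y)) :
    AbsolutelyContinuousOnInterval f a b := by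
  have h0 := Tendsto.const_mul K hg
  rw [mul_zero] at h0
  refine squeeze_zero' (.of_forall fun _ => Finset.sum_nonneg fun _ _ => dist_nonneg) ?_ h0
  have : ∀ᶠ E in AbsolutelyContinuousOnInterval.totalLengthFilter ⊓
      𝓟 (AbsolutelyContinuousOnInterval.disjWithin a b),
      E ∈ AbsolutelyContinuousOnInterval.disjWithin a b :=
    eventually_inf_principal.mpr (by simp)
  filter_upwards [this] with E hE
  rw [Finset.mul_sum]
  exact Finset.sum_le_sum fun i hi => h _ (hE.1 i hi).1 _ (hE.1 i hi).2

/-! ### Primitives of locally integrable functions and their chain rule -/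

/-- `u` is a (locally absolutely continuous) primitive of the locally integrable function `g`. -/
structure IsPrimitive (u g : ℝ → ℂ) : Prop where
  locallyIntegrable : LocallyIntegrable g volume
  sub_eq : ∀ x y, u y - u x = ∫ t in x..y, g t

namespace IsPrimitive

variable {u g v k : ℝ → ℂ}

theorem intervalIntegrable (h : IsPrimitive u g) (a b : ℝ) : IntervalIntegrable g volume a b :=
  (h.locallyIntegrable.integrableOn_isCompact isCompact_uIcc).intervalIntegrable

theorem _root_.MeasureTheory.LocallyIntegrable.isPrimitive {g : ℝ → ℂ}
    (hg : LocallyIntegrable g volume) (c : ℂ) :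
    IsPrimitive (fun x => c + ∫ t in (0 : ℝ)..x, g t) g := by
  refine ⟨hg, fun x y => ?_⟩
  have hi : ∀ a b, IntervalIntegrable g volume a b := fun a b =>
    (hg.integrableOn_isCompact isCompact_uIcc).intervalIntegrable
  rw [add_sub_add_left_eq_sub, intervalIntegral.integral_interval_sub_left (hi _ _) (hi _ _)]

theorem of_contDiff {φ : ℝ → ℂ} (hφ : ContDiff ℝ 1 φ) : IsPrimitive φ (deriv φ) := by
  have hc := hφ.continuous_deriv le_rfl
  refine ⟨hc.locallyIntegrable, fun x y => ?_⟩
  rw [intervalIntegral.integral_deriv_eq_sub]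
  · exact fun t _ => (hφ.differentiable one_ne_zero).differentiableAt
  · exact hc.intervalIntegrable _ _

theorem absolutelyContinuousOnInterval (h : IsPrimitive u g) (a b : ℝ) :
    AbsolutelyContinuousOnInterval u a b := by
  have hP : AbsolutelyContinuousOnInterval (fun x => ∫ t in a..x, ‖g t‖) a b :=
    (h.intervalIntegrable a b).norm.absolutelyContinuousOnInterval_intervalIntegral
      left_mem_uIcc
  refine hP.of_dist_le (K := 1) fun x _ y _ => ?_
  rw [one_mul, dist_comm, dist_eq_norm, h.sub_eq, dist_comm, Real.dist_eq,
    intervalIntegral.integral_interval_sub_left (h.intervalIntegrable _ _).norm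
      (h.intervalIntegrable _ _).norm]
  exact intervalIntegral.norm_integral_le_abs_integral_norm

theorem continuous (h : IsPrimitive u g) : Continuous u := by
  rw [continuous_iff_continuousAt]
  intro x
  refine ((h.absolutelyContinuousOnInterval (x - 1) (x + 1)).continuousOn).continuousAt ?_
  rw [uIcc_of_le (by linarith)]
  exact Icc_mem_nhds (by linarith) (by linarith)

theorem ae_hasDerivAt (h : IsPrimitive u g) : ∀ᵐ x, HasDerivAt u (g x) x := by
  filter_upwards [_root_.LocallyIntegrable.ae_hasDerivAt_integral h.locallyIntegrable] with x hx
  have := (hx 0).const_add (u 0)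
  refine this.congr_of_eventuallyEq (.of_forall fun y => ?_)
  simp only [← h.sub_eq, add_sub_cancel]

/-- An absolutely continuous function with a.e. derivative `g` is a primitive of `g`. -/
theorem of_ae_hasDerivAt (hg : LocallyIntegrable g volume)
    (hu : ∀ a b, AbsolutelyContinuousOnInterval u a b) (hd : ∀ᵐ x, HasDerivAt u (g x) x) :
    IsPrimitive u g := by
  refine ⟨hg, fun x y => ?_⟩
  have hp := hg.isPrimitive 0
  have hac : AbsolutelyContinuousOnInterval (u - fun x => 0 + ∫ t in (0 : ℝ)..x, g t) x y :=
    (hu x y).sub (hp.absolutelyContinuousOnInterval x y)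
  obtain ⟨C, hC⟩ := hac.const_of_ae_hasDerivAt_zero (by
    filter_upwards [hd, hp.ae_hasDerivAt] with t h1 h2 _
    simpa using h1.sub h2)
  have h1 := hC x left_mem_uIcc
  have h2 := hC y right_mem_uIcc
  rw [← hp.sub_eq x y]
  simp only [Pi.sub_apply] at h1 h2
  linear_combination h2 - h1

theorem mul (hu : IsPrimitive u g) (hv : IsPrimitive v k) :
    IsPrimitive (fun x => u x * v x) (fun x => g x * v x + u x * k x) := by
  refine of_ae_hasDerivAt ?_ (fun a b => ?_) ?_
  · refine LocallyIntegrable.add ?_ ?_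
    · exact locallyIntegrableOn_univ.1
        ((locallyIntegrableOn_univ.2 hu.locallyIntegrable).mul_continuousOn hv.continuous.continuousOn
          isOpen_univ.isLocallyClosed)
    · exact locallyIntegrableOn_univ.1
        ((locallyIntegrableOn_univ.2 hv.locallyIntegrable).continuousOn_mul hu.continuous.continuousOn
          isOpen_univ.isLocallyClosed)
  · exact (hu.absolutelyContinuousOnInterval a b).smul (hv.absolutelyContinuousOnInterval a b)
  · filter_upwards [hu.ae_hasDerivAt, hv.ae_hasDerivAt] with x h1 h2
    exact h1.mul h2

/-- Chain rule bound for functions of the modulus of a primitive. -/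
theorem abs_sub_le_integral (h : IsPrimitive u g) {H η : ℝ → ℝ}
    (hH : ∀ t, HasDerivAt H (η t) t) (hη : Continuous η) {a b : ℝ} (hab : a ≤ b) :
    |H ‖u b‖ - H ‖u a‖| ≤ ∫ x in a..b, |η ‖u x‖| * ‖g x‖ := by
  have hN : AbsolutelyContinuousOnInterval (fun x => ‖u x‖) a b := by
    refine (h.absolutelyContinuousOnInterval a b).of_dist_le (K := 1) fun x _ y _ => ?_
    rw [one_mul]
    simpa only [dist_eq_norm] using dist_norm_norm_le (u x) (u y)
  have hH1 : ContDiff ℝ 1 H := by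
    rw [contDiff_one_iff_deriv]
    refine ⟨fun t => (hH t).differentiableAt, ?_⟩
    rwa [show deriv H = η from funext fun t => (hH t).deriv]
  -- A `C¹` function `H` is Lipschitz only on bounded sets, so the values of `‖u‖` are first
  -- confined to `[0, C]`.
  obtain ⟨C, hC⟩ := (isCompact_uIcc (a := a) (b := b)).exists_bound_of_continuousOn
    h.continuous.continuousOn
  obtain ⟨K, hK⟩ := (hH1.contDiffOn (s := Icc 0 C)).exists_lipschitzOnWith (by decide)
    (convex_Icc _ _) isCompact_Icc
  have hF : AbsolutelyContinuousOnInterval (fun x => H ‖u x‖) a b :=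
    hN.of_dist_le (K := K) fun x hx y hy =>
      hK.dist_le_mul _ ⟨norm_nonneg _, hC x hx⟩ _ ⟨norm_nonneg _, hC y hy⟩
  rw [← hF.integral_deriv_eq_sub, ← Real.norm_eq_abs]
  refine intervalIntegral.norm_integral_le_of_norm_le hab ?_ ?_
  · filter_upwards [hN.ae_differentiableAt, h.ae_hasDerivAt] with x h1 h2 hx
    have hx' : x ∈ uIcc a b := uIoc_subset_uIcc (by rwa [uIoc_of_le hab])
    have h3 := (h1 hx').hasDerivAt
    have h4 := (hH ‖u x‖).comp x h3
    rw [show (fun x => H ‖u x‖) = H ∘ fun x => ‖u x‖ from rfl, h4.deriv, norm_mul,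
      Real.norm_eq_abs]
    refine mul_le_mul_of_nonneg_left ?_ (abs_nonneg _)
    -- Comparing difference quotients by the reverse triangle inequality gives `| ‖u‖' | ≤ ‖g‖`
    -- without differentiating the norm, which fails at zeros of `u`.
    rw [hasDerivAt_iff_tendsto_slope] at h2 h3
    refine le_of_tendsto_of_tendsto' h3.norm h2.norm fun y => ?_
    rw [slope_def_module, slope_def_module, norm_smul, norm_smul]
    exact mul_le_mul_of_nonneg_left (abs_norm_sub_norm_le _ _) (norm_nonneg _)
  · refine IntervalIntegrable.continuousOn_mul (h.intervalIntegrable a b).norm ?_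
    exact (hη.comp h.continuous.norm).abs.continuousOn

end IsPrimitive

/-! ### The action and the energy inequality -/

/-- The weight `w² √(m² - w²)` for which the extremal profile of height `m` solves `|u'| = w(u)`. -/
noncomputable def profileSpeed (m w : ℝ) : ℝ := w ^ 2 * √(m ^ 2 - w ^ 2)

/-- The primitive of `profileSpeed m` vanishing at `0`. -/
noncomputable def profileAction (m t : ℝ) : ℝ := ∫ w in (0 : ℝ)..t, profileSpeed m w

theorem continuous_profileSpeed (m : ℝ) : Continuous (profileSpeed m) := by
  unfold profileSpeed; fun_prop

theorem profileSpeed_nonneg (m w : ℝ) : 0 ≤ profileSpeed m w := by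
  unfold profileSpeed; positivity

theorem profileSpeed_sq {m w : ℝ} (hw : 0 ≤ w) (hm : w ≤ m) :
    profileSpeed m w ^ 2 = m ^ 2 * w ^ 4 - w ^ 6 := by
  rw [profileSpeed, mul_pow, Real.sq_sqrt (by nlinarith)]; ring

theorem hasDerivAt_profileAction (m t : ℝ) :
    HasDerivAt (profileAction m) (profileSpeed m t) t :=
  intervalIntegral.integral_hasDerivAt_right
    ((continuous_profileSpeed m).intervalIntegrable _ _)
    ((continuous_profileSpeed m).stronglyMeasurableAtFilter _ _)
    (continuous_profileSpeed m).continuousAt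

theorem continuous_profileAction (m : ℝ) : Continuous (profileAction m) :=
  continuous_iff_continuousAt.2 fun t => (hasDerivAt_profileAction m t).continuousAt

theorem profileAction_zero (m : ℝ) : profileAction m 0 = 0 := by simp [profileAction]

/-- The substitution `w = m sin θ` reduces the integral to `m⁴ ∫ sin² cos²` over a quarter period.
This is where the `π` of the sharp constant arises. -/
theorem profileAction_self {m : ℝ} (hm : 0 ≤ m) : profileAction m m = Real.pi * m ^ 4 / 16 := by
  have h := intervalIntegral.integral_comp_mul_deriv (a := 0) (b := Real.pi / 2)
    (f := fun θ => m * Real.sin θ) (f' := fun θ => m * Real.cos θ) (g := profileSpeed m)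
    (fun x _ => (Real.hasDerivAt_sin x).const_mul m) (by fun_prop) (continuous_profileSpeed m)
  simp only [Function.comp_def, Real.sin_zero, mul_zero, Real.sin_pi_div_two, mul_one] at h
  rw [profileAction, ← h]
  have h2 : ∀ θ ∈ uIcc 0 (Real.pi / 2),
      profileSpeed m (m * Real.sin θ) * (m * Real.cos θ) =
        m ^ 4 * (Real.sin θ ^ 2 * Real.cos θ ^ 2) := by
    intro θ hθ
    rw [uIcc_of_le (by positivity)] at hθ
    have hc : 0 ≤ Real.cos θ :=
      Real.cos_nonneg_of_mem_Icc ⟨by linarith [hθ.1, Real.pi_pos], hθ.2⟩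
    have : m ^ 2 - (m * Real.sin θ) ^ 2 = (m * Real.cos θ) ^ 2 := by
      rw [mul_pow, mul_pow, Real.cos_sq']; ring
    rw [profileSpeed, this, Real.sqrt_sq (by positivity)]
    ring
  rw [intervalIntegral.integral_congr h2, intervalIntegral.integral_const_mul,
    integral_sin_sq_mul_cos_sq]
  have : Real.sin (4 * (Real.pi / 2)) = 0 := by
    rw [show 4 * (Real.pi / 2) = 2 * Real.pi by ring, Real.sin_two_pi]
  rw [this]
  simp
  ring

/-- The local energy inequality behind the sharp constant. -/
theorem IsPrimitive.action_le {u g : ℝ → ℂ} (h : IsPrimitive u g) {a b m : ℝ} (hab : a ≤ b)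
    (hg : IntervalIntegrable (fun x => ‖g x‖ ^ 2) volume a b) (hm : ∀ x ∈ Icc a b, ‖u x‖ ≤ m)
    {l : ℝ} (hl : 0 ≤ l) :
    2 * l * |profileAction m ‖u b‖ - profileAction m ‖u a‖| ≤
      (∫ x in a..b, ‖g x‖ ^ 2) + l ^ 2 * (m ^ 2 * (∫ x in a..b, ‖u x‖ ^ 4) -
        ∫ x in a..b, ‖u x‖ ^ 6) := by
  have hc := h.continuous
  have h4 : IntervalIntegrable (fun x => ‖u x‖ ^ 4) volume a b :=
    (by fun_prop : Continuous fun x => ‖u x‖ ^ 4).intervalIntegrable _ _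
  have h6 : IntervalIntegrable (fun x => ‖u x‖ ^ 6) volume a b :=
    (by fun_prop : Continuous fun x => ‖u x‖ ^ 6).intervalIntegrable _ _
  have h1 := h.abs_sub_le_integral (hasDerivAt_profileAction m) (continuous_profileSpeed m) hab
  refine (mul_le_mul_of_nonneg_left h1 (by positivity)).trans ?_
  rw [← intervalIntegral.integral_const_mul, ← intervalIntegral.integral_const_mul,
    ← intervalIntegral.integral_sub (h4.const_mul _) h6, ← intervalIntegral.integral_const_mul,
    ← intervalIntegral.integral_add hg (((h4.const_mul _).sub h6).const_mul _)]
  refine intervalIntegral.integral_mono_on hab ?_ (hg.add (((h4.const_mul _).sub h6).const_mul _))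
    fun x hx => ?_
  · refine IntervalIntegrable.const_mul ?_ _
    refine IntervalIntegrable.continuousOn_mul (h.intervalIntegrable a b).norm ?_
    exact ((continuous_profileSpeed m).comp hc.norm).abs.continuousOn
  -- Young's inequality pointwise; the bound `‖u‖ ≤ m` keeps the radicand nonnegative, so the
  -- squared speed is the polynomial in the energy.
  · rw [← profileSpeed_sq (norm_nonneg _) (hm x hx), abs_of_nonneg (profileSpeed_nonneg _ _)]
    nlinarith [sq_nonneg (‖g x‖ - l * profileSpeed m ‖u x‖)]

/-- The scaling optimisation turning the energy inequality into the multiplicative one. -/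
theorem pow_three_le_of_forall_energy {A B G m : ℝ} (hA : 0 ≤ A) (hG : 0 ≤ G)
    (hm : 0 ≤ m) (hGB : G ≤ m ^ 2 * B)
    (h : ∀ l : ℝ, 0 < l → l * (Real.pi * m ^ 4 / 4) ≤ A + l ^ 2 * (m ^ 2 * B - G)) :
    G ^ 3 ≤ 27 / (4 * Real.pi ^ 2) * A * B ^ 4 := by
  have hpi := Real.pi_pos
  rcases hm.eq_or_lt with rfl | hm
  · have : G = 0 := le_antisymm (by simpa using hGB) hG
    subst this
    have : 0 ≤ B ^ 4 := by positivity
    simp only [ne_eq, OfNat.ofNat_ne_zero, not_false_eq_true, zero_pow]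
    positivity
  have hB : 0 ≤ B := by
    by_contra hB
    nlinarith [mul_pos_of_neg_of_neg (not_le.1 hB) (neg_neg_of_pos (by positivity : 0 < m ^ 2))]
  -- The hypothesis covers `x > 0`. For `x ≤ 0` every term of the quadratic is nonnegative, the
  -- leading one by `hGB`.
  have hdisc : discrim (m ^ 2 * B - G) (-(Real.pi * m ^ 4 / 4)) A ≤ 0 := by
    refine discrim_le_zero fun x => ?_
    rcases lt_or_ge 0 x with hx | hx
    · linarith [h x hx]
    · have h1 : 0 ≤ (m ^ 2 * B - G) * (x * x) := mul_nonneg (by linarith) (mul_self_nonneg x)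
      have h2 : 0 ≤ (Real.pi * m ^ 4 / 4) * (-x) := mul_nonneg (by positivity) (by linarith)
      linarith
  -- The `G` term is split into three equal parts so that AM-GM on four terms yields `s⁴ G³`, whose
  -- `s⁴` cancels against the right-hand side.
  have hkey : Real.pi ^ 2 * (m ^ 2) ^ 4 + 3 * (64 * A * G / 3) ≤ 64 * A * (m ^ 2) * B := by
    unfold discrim at hdisc
    linarith
  set s := m ^ 2 with hs
  have hs0 : 0 < s := by positivity
  have ham : ∀ x y : ℝ, 0 ≤ x → 0 ≤ y → 256 * (x * y ^ 3) ≤ (x + 3 * y) ^ 4 := by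
    intro x y hx hy
    -- This product is exactly `(x + 3y)⁴ - 256xy³`.
    have : 0 ≤ (x - y) ^ 2 * (x ^ 2 + 14 * x * y + 81 * y ^ 2) := by positivity
    linarith
  have h1 := ham (Real.pi ^ 2 * s ^ 4) (64 * A * G / 3) (by positivity) (by positivity)
  have h2 := h1.trans (pow_le_pow_left₀ (by positivity) hkey 4)
  rcases hA.eq_or_lt with rfl | hA
  · exfalso
    have : 0 < Real.pi ^ 2 * s ^ 4 := by positivity
    linarith
  have h3 : (256 * 64 ^ 3 * s ^ 4 * A ^ 3 * Real.pi ^ 2 / 27) * G ^ 3 ≤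
      (256 * 64 ^ 3 * s ^ 4 * A ^ 3 * Real.pi ^ 2 / 27) *
        (27 / (4 * Real.pi ^ 2) * A * B ^ 4) := by
    have e : (256 * 64 ^ 3 * s ^ 4 * A ^ 3 * Real.pi ^ 2 / 27) *
        (27 / (4 * Real.pi ^ 2) * A * B ^ 4) = (64 * A * s * B) ^ 4 := by
      field_simp
      norm_num
    rw [e]
    refine le_trans (le_of_eq ?_) h2
    ring
  exact le_of_mul_le_mul_left h3 (by positivity)

/-! ### Passing between integrals and norms -/

namespace GNTorus

theorem CGN_nonneg : 0 ≤ CGN := by unfold CGN; positivity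

theorem CGN_pow : CGN ^ 18 = 27 / (4 * Real.pi ^ 2) := by
  have hpi := Real.pi_pos
  rw [CGN, mul_pow, ← Real.rpow_natCast, ← Real.rpow_natCast, ← Real.rpow_mul (by norm_num),
    ← Real.rpow_mul (by positivity)]
  rw [show (1 / 6 : ℝ) * ((18 : ℕ) : ℝ) = ((3 : ℕ) : ℝ) by norm_num,
    show (-(1 / 9) : ℝ) * ((18 : ℕ) : ℝ) = -((2 : ℕ) : ℝ) by norm_num, Real.rpow_neg (by positivity),
    Real.rpow_natCast, Real.rpow_natCast]
  field_simp
  norm_num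

/-- Raising to the power 18 clears all the fractional exponents at once. -/
theorem le_CGN_mul_of_pow_le {x a b k : ℝ} (ha : 0 ≤ a) (hb : 0 ≤ b) (hk : 0 ≤ k)
    (h : x ^ 18 ≤ 27 / (4 * Real.pi ^ 2) * a * (k * b ^ 4) ^ 4) :
    x ≤ CGN * k ^ (2 / 9 : ℝ) * a ^ (1 / 18 : ℝ) * b ^ (8 / 9 : ℝ) := by
  have hC := CGN_nonneg
  refine le_of_pow_le_pow_left₀ (n := 18) (by norm_num) (by positivity) (h.trans (le_of_eq ?_))
  have e : ∀ (y : ℝ) (r : ℝ) (n : ℕ), 0 ≤ y → r * 18 = n → (y ^ r) ^ 18 = y ^ n := by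
    intro y r n hy hr
    rw [← Real.rpow_natCast, ← Real.rpow_mul hy]
    push_cast
    rw [hr, Real.rpow_natCast]
  rw [mul_pow (CGN * _ * _), mul_pow (CGN * _), mul_pow CGN, CGN_pow, e k _ 4 hk (by norm_num), e a _ 1 ha (by norm_num),
    e b _ 16 hb (by norm_num)]
  ring

theorem lpNorm_pow_eq_integral {α : Type*} [MeasurableSpace α] {μ : Measure α} {f : α → ℂ}
    {p : ENNReal} (hf : AEStronglyMeasurable f μ) (n : ℕ) (hn : n ≠ 0) (hp : p = n) :
    lpNorm f p μ ^ n = ∫ x, ‖f x‖ ^ n ∂μ := by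
  subst hp
  rw [lpNorm_eq_integral_norm_rpow_toReal (by exact_mod_cast hn) (ENNReal.natCast_ne_top n) hf,
    ← Real.rpow_natCast _ n, ← Real.rpow_mul (integral_nonneg fun x => by positivity)]
  simp [hn]

end GNTorus

/-! ### Weak derivatives on the line -/

theorem HasCompactSupport.exists_tsupport_subset_Ioo {φ : ℝ → ℂ} (h : HasCompactSupport φ) :
    ∃ R : ℝ, 0 < R ∧ tsupport φ ⊆ Ioo (-R) R := by
  obtain ⟨R, hR⟩ := h.isCompact.isBounded.subset_ball (0 : ℝ)
  refine ⟨max R 1, by positivity, hR.trans fun x hx => ?_⟩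
  rw [Metric.mem_ball, dist_zero_right, Real.norm_eq_abs] at hx
  exact abs_lt.1 (hx.trans_le (le_max_left _ _))

/-- Integration by parts of a primitive against a `C¹` function on an interval. -/
theorem IsPrimitive.integral_mul_deriv {u g φ : ℝ → ℂ} (h : IsPrimitive u g)
    (hφ : ContDiff ℝ 1 φ) (a b : ℝ) :
    ∫ x in a..b, u x * deriv φ x = u b * φ b - u a * φ a - ∫ x in a..b, g x * φ x := by
  have hp := IsPrimitive.of_contDiff hφ
  rw [(h.mul hp).sub_eq, intervalIntegral.integral_add, add_sub_cancel_left]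
  · exact (h.intervalIntegrable a b).mul_continuousOn hp.continuous.continuousOn
  · exact (hp.intervalIntegrable a b).continuousOn_mul h.continuous.continuousOn

/-- A primitive of `g` has weak derivative `g`. -/
theorem IsPrimitive.integral_mul_deriv_of_hasCompactSupport {u g φ : ℝ → ℂ} (h : IsPrimitive u g)
    (hφ : ContDiff ℝ 1 φ) (hs : HasCompactSupport φ) :
    ∫ x, u x * deriv φ x = -∫ x, g x * φ x := by
  obtain ⟨R, hR0, hR⟩ := hs.exists_tsupport_subset_Ioo
  have hsub : Ioo (-R) R ⊆ Ioc (-R) R := Ioo_subset_Ioc_self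
  have e1 : ∫ x, u x * deriv φ x = ∫ x in (-R)..R, u x * deriv φ x :=
    (intervalIntegral.integral_eq_integral_of_support_subset
      ((Function.support_mul_subset_right _ _).trans
        ((support_deriv_subset).trans (hR.trans hsub)))).symm
  have e2 : ∫ x, g x * φ x = ∫ x in (-R)..R, g x * φ x :=
    (intervalIntegral.integral_eq_integral_of_support_subset
      ((Function.support_mul_subset_right _ _).trans
        ((subset_tsupport _).trans (hR.trans hsub)))).symm
  have z : ∀ x, x ∉ Ioo (-R) R → φ x = 0 := fun x hx =>
    image_eq_zero_of_notMem_tsupport fun hx' => hx (hR hx')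
  rw [e1, e2, h.integral_mul_deriv hφ, z R (by simp), z (-R) (by simp)]
  simp

/-- A smooth compactly supported function with zero integral is the derivative of a smooth
compactly supported function. -/
theorem exists_hasDerivAt_of_integral_eq_zero {χ : ℝ → ℂ} (hχ : ContDiff ℝ ∞ χ)
    (hs : HasCompactSupport χ) (h0 : ∫ x, χ x = 0) :
    ∃ φ : ℝ → ℂ, ContDiff ℝ ∞ φ ∧ HasCompactSupport φ ∧ deriv φ = χ := by
  obtain ⟨R, hR0, hR⟩ := hs.exists_tsupport_subset_Ioo
  have z : ∀ x, x ∉ Ioo (-R) R → χ x = 0 := fun x hx =>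
    image_eq_zero_of_notMem_tsupport fun hx' => hx (hR hx')
  have hi : ∀ a b, IntervalIntegrable χ volume a b := fun a b =>
    hχ.continuous.intervalIntegrable _ _
  have hd : ∀ x, HasDerivAt (fun x => ∫ t in (-R)..x, χ t) (χ x) x := fun x =>
    intervalIntegral.integral_hasDerivAt_right (hi _ _)
      (hχ.continuous.stronglyMeasurableAtFilter _ _) hχ.continuous.continuousAt
  have hde : deriv (fun x => ∫ t in (-R)..x, χ t) = χ := funext fun x => (hd x).deriv
  refine ⟨_, ?_, ?_, hde⟩
  · rw [contDiff_infty_iff_deriv, hde]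
    exact ⟨fun x => (hd x).differentiableAt, hχ⟩
  · refine HasCompactSupport.intro (isCompact_Icc (a := -R) (b := R)) fun x hx => ?_
    rcases lt_or_ge x (-R) with h | h
    · rw [intervalIntegral.integral_symm, intervalIntegral.integral_congr (g := fun _ => 0)]
      · simp
      · intro t ht
        rw [uIcc_of_le h.le] at ht
        exact z t fun h' => absurd h'.1 (not_lt.2 ht.2)
    · have h' : R < x := by
        by_contra h'
        exact hx ⟨h, not_lt.1 h'⟩
      rw [intervalIntegral.integral_eq_integral_of_support_subset, h0]
      intro t ht
      have := hR (subset_tsupport _ ht)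
      exact ⟨this.1, this.2.le.trans h'.le⟩

/-- The lemma of du Bois-Reymond. -/
theorem ae_eq_const_of_integral_mul_deriv_eq_zero {w : ℝ → ℂ} (hw : LocallyIntegrable w volume)
    (h : ∀ φ : ℝ → ℂ, ContDiff ℝ ∞ φ → HasCompactSupport φ → ∫ x, w x * deriv φ x = 0) :
    ∃ c : ℂ, w =ᵐ[volume] fun _ => c := by
  let b : ContDiffBump (0 : ℝ) := default
  let ψ₀ : ℝ → ℝ := b.normed volume
  have hb1 : ContDiff ℝ ∞ ψ₀ := b.contDiff_normed
  have hb2 : HasCompactSupport ψ₀ := b.hasCompactSupport_normed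
  have hb3 : ∫ x, ψ₀ x = 1 := b.integral_normed
  refine ⟨∫ x, ψ₀ x • w x, ?_⟩
  set c := ∫ x, ψ₀ x • w x with hc
  have hwc : LocallyIntegrable (fun x => w x - c) volume := hw.sub (locallyIntegrable_const c)
  have key := ae_eq_zero_of_integral_contDiff_smul_eq_zero hwc fun ψ hψ1 hψ2 => by
    set s : ℝ := ∫ x, ψ x with hs
    -- Subtracting a multiple of the unit-mass bump makes the mean zero, so `χ` is the derivative of
    -- an admissible test function.
    let χ : ℝ → ℂ := fun x => ((ψ x - s * ψ₀ x : ℝ) : ℂ)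
    have hi : Integrable ψ volume := hψ1.continuous.integrable_of_hasCompactSupport hψ2
    have hi0 : Integrable ψ₀ volume := hb1.continuous.integrable_of_hasCompactSupport hb2
    have hcs : HasCompactSupport fun x => ψ x - s * ψ₀ x := hψ2.sub hb2.mul_left
    obtain ⟨φ, h1, h2, h3⟩ := exists_hasDerivAt_of_integral_eq_zero (χ := χ)
      (Complex.ofRealCLM.contDiff.comp (hψ1.sub (contDiff_const.mul hb1)))
      (hcs.comp_left (g := ((↑) : ℝ → ℂ)) Complex.ofReal_zero)
      (by
        have : ∫ x, (ψ x - s * ψ₀ x) = 0 := by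
          rw [integral_sub hi (hi0.const_mul s), integral_const_mul, hb3, hs]; ring
        rw [show ∫ x, χ x = ((∫ x, (ψ x - s * ψ₀ x) : ℝ) : ℂ) from integral_ofReal, this]; simp)
    have h4 := h φ h1 h2
    rw [h3] at h4
    have j1 : Integrable (fun x => ψ x • w x) volume :=
      hw.integrable_smul_left_of_hasCompactSupport hψ1.continuous hψ2
    have j2 : Integrable (fun x => ψ₀ x • w x) volume :=
      hw.integrable_smul_left_of_hasCompactSupport hb1.continuous hb2
    have h5 : ∫ x, w x * χ x = (∫ x, ψ x • w x) - s • ∫ x, ψ₀ x • w x := by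
      rw [← integral_smul, ← integral_sub (g := fun x => s • ψ₀ x • w x) j1 (j2.smul s)]
      congr 1 with x
      simp only [χ, Complex.real_smul]
      push_cast
      ring
    rw [← hc, h4] at h5
    have h6 : ∫ x, ψ x • (w x - c) = (∫ x, ψ x • w x) - s • c := by
      rw [hs, ← integral_smul_const, ← integral_sub j1 (hi.smul_const c)]
      congr 1 with x
      rw [smul_sub]
    rw [h6, ← h5]
  filter_upwards [key] with x hx
  exact sub_eq_zero.1 hx

/-- The difference between `f` and any primitive of `g` has zero weak derivative, hence is a.e.
constant. -/
theorem GNTorus.IsH1Line.exists_isPrimitive {f g : ℝ → ℂ} (h : GNTorus.IsH1Line f g) :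
    ∃ u, IsPrimitive u g ∧ f =ᵐ[volume] u := by
  have hf : LocallyIntegrable f volume := h.memLp.locallyIntegrable (by norm_num)
  have hg : LocallyIntegrable g volume := h.memLp_deriv.locallyIntegrable (by norm_num)
  have hp := hg.isPrimitive 0
  set v : ℝ → ℂ := fun x => 0 + ∫ t in (0 : ℝ)..x, g t with hv
  have hvl : LocallyIntegrable v volume := hp.continuous.locallyIntegrable
  obtain ⟨c, hc⟩ := ae_eq_const_of_integral_mul_deriv_eq_zero (hf.sub hvl) fun φ h1 h2 => by
    have hdc : Continuous (deriv φ) := h1.continuous_deriv (by simp)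
    have j : ∀ w : ℝ → ℂ, LocallyIntegrable w volume →
        Integrable (fun x => w x * deriv φ x) volume := fun w hw => by
      simpa only [smul_eq_mul] using hw.integrable_smul_right_of_hasCompactSupport hdc h2.deriv
    simp only [Pi.sub_apply, sub_mul]
    rw [integral_sub (j f hf) (j v hvl), h.weak_deriv φ h1 h2,
      hp.integral_mul_deriv_of_hasCompactSupport (h1.of_le (by simp)) h2, sub_self]
  refine ⟨_, hg.isPrimitive c, ?_⟩
  filter_upwards [hc] with x hx
  simp only [Pi.sub_apply, hv, zero_add] at hx
  rw [← hx]; ring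

/-! ### The sharp inequality on the line -/

/-- Applied to half-lines, this supplies points on either side where `|u|` is small, so decay at
infinity need not be proved. -/
theorem MeasureTheory.Integrable.exists_lt_of_nonneg {F : ℝ → ℝ} (hF : Integrable F volume)
    {s : Set ℝ} (hms : MeasurableSet s) (hs : volume s = ⊤) {ε : ℝ} (hε : 0 < ε) :
    ∃ x ∈ s, F x < ε := by
  by_contra! hcon
  have h1 : IntegrableOn (fun _ : ℝ => ε) s volume := by
    refine (hF.integrableOn (s := s)).mono' aestronglyMeasurable_const ?_
    refine (ae_restrict_iff' hms).2 (.of_forall fun x hx => ?_)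
    rw [Real.norm_of_nonneg hε.le]
    exact hcon x hx
  rw [integrableOn_const_iff] at h1
  rcases h1 with h1 | h1
  · exact hε.ne' (enorm_eq_zero.1 h1)
  · simp [hs] at h1

namespace IsPrimitive

variable {u g : ℝ → ℂ}

/-- A square integrable function with square integrable derivative is bounded. -/
theorem exists_norm_le (h : IsPrimitive u g) (hu : MemLp u 2 volume) (hg : MemLp g 2 volume) :
    ∃ C, ∀ x, ‖u x‖ ≤ C := by
  have hi : Integrable (fun x => |2 * ‖u x‖| * ‖g x‖) volume := by
    have := (hu.norm.integrable_mul hg.norm).const_mul 2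
    refine this.congr (.of_forall fun x => ?_)
    simp only [abs_mul, abs_norm, Nat.abs_ofNat, Pi.mul_apply]
    ring
  set I := ∫ x, |2 * ‖u x‖| * ‖g x‖ with hI
  have hle : ∀ a b, a ≤ b → |‖u b‖ ^ 2 - ‖u a‖ ^ 2| ≤ I := fun a b hab => by
    refine (h.abs_sub_le_integral (H := fun t => t ^ 2) (η := fun t => 2 * t)
      (fun t => by simpa using hasDerivAt_pow 2 t) (by fun_prop) hab).trans ?_
    rw [intervalIntegral.integral_of_le hab]
    exact setIntegral_le_integral hi (.of_forall fun x => by positivity)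
  have hb : ∀ x, ‖u x‖ ^ 2 ≤ ‖u 0‖ ^ 2 + I := fun x => by
    rcases le_total 0 x with hx | hx
    · linarith [(abs_le.1 (hle 0 x hx)).2]
    · linarith [(abs_le.1 (hle x 0 hx)).1]
  exact ⟨√(‖u 0‖ ^ 2 + I), fun x => Real.le_sqrt_of_sq_le (hb x)⟩

/-- The energy inequality along a path `a ≤ c ≤ b` passing through a high value at `c`. -/
theorem two_action_le (h : IsPrimitive u g) {a b c m : ℝ} (hac : a ≤ c) (hcb : c ≤ b)
    (hg : ∀ x y, IntervalIntegrable (fun x => ‖g x‖ ^ 2) volume x y)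
    (hm : ∀ x, ‖u x‖ ≤ m) {l : ℝ} (hl : 0 ≤ l) :
    2 * l * (2 * profileAction m ‖u c‖ - profileAction m ‖u a‖ - profileAction m ‖u b‖) ≤
      (∫ x in a..b, ‖g x‖ ^ 2) + l ^ 2 * (m ^ 2 * (∫ x in a..b, ‖u x‖ ^ 4) -
        ∫ x in a..b, ‖u x‖ ^ 6) := by
  have hc := h.continuous
  have hi : ∀ n : ℕ, ∀ x y, IntervalIntegrable (fun x => ‖u x‖ ^ n) volume x y := fun n x y =>
    (by fun_prop : Continuous fun x => ‖u x‖ ^ n).intervalIntegrable _ _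
  have h1 := h.action_le hac (hg a c) (fun x _ => hm x) hl
  have h2 := h.action_le hcb (hg c b) (fun x _ => hm x) hl
  rw [← intervalIntegral.integral_add_adjacent_intervals (hg a c) (hg c b),
    ← intervalIntegral.integral_add_adjacent_intervals (hi 4 a c) (hi 4 c b),
    ← intervalIntegral.integral_add_adjacent_intervals (hi 6 a c) (hi 6 c b)]
  have h3 := mul_le_mul_of_nonneg_left
    (le_abs_self (profileAction m ‖u c‖ - profileAction m ‖u a‖)) (by positivity : 0 ≤ 2 * l)
  have h4 := mul_le_mul_of_nonneg_left
    (neg_le_abs (profileAction m ‖u b‖ - profileAction m ‖u c‖)) (by positivity : 0 ≤ 2 * l)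
  linarith

theorem integrable_norm_pow (hu : MemLp u 2 volume) {C : ℝ} (hC : ∀ x, ‖u x‖ ≤ C) (n : ℕ) :
    Integrable (fun x => ‖u x‖ ^ (n + 2)) volume := by
  have h2 : Integrable (fun x => ‖u x‖ ^ 2) volume := hu.integrable_norm_pow two_ne_zero
  refine (h2.const_mul (C ^ n)).mono' (hu.1.norm.pow _) (.of_forall fun x => ?_)
  rw [Real.norm_of_nonneg (by positivity), pow_add]
  gcongr
  exact hC x

/-- The sharp inequality on the line, for primitives. -/
theorem integral_pow_six_le (h : IsPrimitive u g) (hu : MemLp u 2 volume)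
    (hg : MemLp g 2 volume) :
    (∫ x, ‖u x‖ ^ 6) ^ 3 ≤
      27 / (4 * Real.pi ^ 2) * (∫ x, ‖g x‖ ^ 2) * (∫ x, ‖u x‖ ^ 4) ^ 4 := by
  obtain ⟨C, hC⟩ := h.exists_norm_le hu hg
  have hbdd : BddAbove (range fun x => ‖u x‖) := ⟨C, by rintro _ ⟨x, rfl⟩; exact hC x⟩
  set m := sSup (range fun x => ‖u x‖) with hmdef
  have hm : ∀ x, ‖u x‖ ≤ m := fun x => le_csSup hbdd (mem_range_self x)
  have hm0 : 0 ≤ m := (norm_nonneg _).trans (hm 0)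
  have i4 := integrable_norm_pow hu hC 2
  have i6 := integrable_norm_pow hu hC 4
  have i2 : Integrable (fun x => ‖g x‖ ^ 2) volume := hg.integrable_norm_pow two_ne_zero
  have iu : Integrable (fun x => ‖u x‖ ^ 2) volume := hu.integrable_norm_pow two_ne_zero
  have hpt : ∀ x, ‖u x‖ ^ 6 ≤ m ^ 2 * ‖u x‖ ^ 4 := fun x => by
    have : ‖u x‖ ^ 2 ≤ m ^ 2 := pow_le_pow_left₀ (norm_nonneg _) (hm x) 2
    nlinarith [pow_nonneg (norm_nonneg (u x)) 4]
  refine pow_three_le_of_forall_energy (m := m) (integral_nonneg fun x => by positivity)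
    (integral_nonneg fun x => by positivity) hm0 ?_ fun l hl => ?_
  · rw [← integral_const_mul]
    exact integral_mono i6 (i4.const_mul _) hpt
  -- The supremum is only approached along `c n`, with `a n` and `b n` on either side where `u`
  -- tends to zero.
  obtain ⟨s, -, hs, hsm⟩ := exists_seq_tendsto_sSup (range_nonempty fun x => ‖u x‖) hbdd
  choose c hcs using hsm
  have hlow : ∀ n : ℕ, ∃ x ∈ Iic (c n), ‖u x‖ ^ 2 < 1 / ((n : ℝ) + 1) := fun n =>
    iu.exists_lt_of_nonneg measurableSet_Iic Real.volume_Iic Nat.one_div_pos_of_nat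
  have hhigh : ∀ n : ℕ, ∃ x ∈ Ici (c n), ‖u x‖ ^ 2 < 1 / ((n : ℝ) + 1) := fun n =>
    iu.exists_lt_of_nonneg measurableSet_Ici Real.volume_Ici Nat.one_div_pos_of_nat
  choose a hac ha using hlow
  choose b hbc hb using hhigh
  have hzero : ∀ d : ℕ → ℝ, (∀ n : ℕ, ‖u (d n)‖ ^ 2 < 1 / ((n : ℝ) + 1)) →
      Tendsto (fun n => profileAction m ‖u (d n)‖) atTop (𝓝 0) := fun d hd => by
    have h1 : Tendsto (fun n => ‖u (d n)‖ ^ 2) atTop (𝓝 0) :=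
      squeeze_zero (fun n => by positivity) (fun n => (hd n).le)
        tendsto_one_div_add_atTop_nhds_zero_nat
    have h2 : Tendsto (fun n => ‖u (d n)‖) atTop (𝓝 0) := by
      simpa using h1.sqrt
    have h3 := ((continuous_profileAction m).tendsto 0).comp h2
    rwa [profileAction_zero] at h3
  have hmax : Tendsto (fun n => profileAction m ‖u (c n)‖) atTop (𝓝 (Real.pi * m ^ 4 / 16)) := by
    have h3 := ((continuous_profileAction m).tendsto m).comp hs
    rw [profileAction_self hm0] at h3
    exact h3.congr fun n => by simp [← hcs n]
  have hlim := (((hmax.const_mul 2).sub (hzero a ha)).sub (hzero b hb)).const_mul (2 * l)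
  have hfin := le_of_tendsto' (b := (∫ x, ‖g x‖ ^ 2) +
      l ^ 2 * (m ^ 2 * (∫ x, ‖u x‖ ^ 4) - ∫ x, ‖u x‖ ^ 6)) hlim fun n => by
    refine (h.two_action_le (hac n) (hbc n)
      (fun x y => i2.intervalIntegrable) hm hl.le).trans ?_
    have hab : a n ≤ b n := le_trans (hac n) (hbc n)
    refine add_le_add ?_ (mul_le_mul_of_nonneg_left ?_ (by positivity))
    · rw [intervalIntegral.integral_of_le hab]
      exact setIntegral_le_integral i2 (.of_forall fun x => by positivity)
    -- The two integrals must be kept together: only the combined integrand is nonnegative, and only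
    -- then does enlarging the interval increase it.
    · rw [← integral_const_mul, ← integral_sub (i4.const_mul _) i6,
        ← intervalIntegral.integral_const_mul, ← intervalIntegral.integral_sub
          (i4.const_mul _).intervalIntegrable i6.intervalIntegrable,
        intervalIntegral.integral_of_le hab]
      exact setIntegral_le_integral ((i4.const_mul _).sub i6)
        (.of_forall fun x => sub_nonneg.2 (hpt x))
  linarith

end IsPrimitive

theorem memLp_of_integrable_norm_pow {α : Type*} [MeasurableSpace α] {μ : Measure α} {f : α → ℂ}
    (hf : AEStronglyMeasurable f μ) {n : ℕ} (hn : n ≠ 0) {p : ENNReal} (hp : p = n)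
    (hi : Integrable (fun x => ‖f x‖ ^ n) μ) : MemLp f p μ := by
  subst hp
  rw [← integrable_norm_rpow_iff hf (by exact_mod_cast hn) (ENNReal.natCast_ne_top n)]
  simpa using hi

namespace GNTorus

/-- Conversion of the integral inequality into an inequality between norms. -/
theorem lpNorm_six_le {α : Type*} [MeasurableSpace α] {μ : Measure α} {f : α → ℂ}
    (hf : AEStronglyMeasurable f μ) {a k : ℝ} (ha : 0 ≤ a) (hk : 0 ≤ k)
    (h : (∫ x, ‖f x‖ ^ 6 ∂μ) ^ 3 ≤
      27 / (4 * Real.pi ^ 2) * a * (k * ∫ x, ‖f x‖ ^ 4 ∂μ) ^ 4) :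
    lpNorm f 6 μ ≤
      CGN * k ^ (2 / 9 : ℝ) * a ^ (1 / 18 : ℝ) * lpNorm f 4 μ ^ (8 / 9 : ℝ) := by
  refine le_CGN_mul_of_pow_le ha lpNorm_nonneg hk ?_
  rw [lpNorm_pow_eq_integral hf 4 (by norm_num) (by norm_num), show 18 = 6 * 3 from rfl, pow_mul,
    lpNorm_pow_eq_integral hf 6 (by norm_num) (by norm_num)]
  exact h

theorem CGN_mem : CGN ∈ gagliardoNirenbergConstants := by
  intro f g h
  obtain ⟨u, hp, hfu⟩ := h.exists_isPrimitive
  have hu : MemLp u 2 volume := (memLp_congr_ae hfu).1 h.memLp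
  have hg := h.memLp_deriv
  obtain ⟨C, hC⟩ := hp.exists_norm_le hu hg
  have m4 : MemLp u 4 volume := memLp_of_integrable_norm_pow hu.1 (n := 4) (by norm_num)
    (by norm_num) (IsPrimitive.integrable_norm_pow hu hC 2)
  have m6 : MemLp u 6 volume := memLp_of_integrable_norm_pow hu.1 (n := 6) (by norm_num)
    (by norm_num) (IsPrimitive.integrable_norm_pow hu hC 4)
  refine ⟨(memLp_congr_ae hfu).2 m4, (memLp_congr_ae hfu).2 m6, ?_⟩
  have e : ∀ n : ℕ, ∫ x, ‖f x‖ ^ n = ∫ x, ‖u x‖ ^ n := fun n =>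
    integral_congr_ae (hfu.mono fun x hx => by simp only [hx])
  have h1 := lpNorm_six_le (f := f) (a := lpNorm g 2 volume ^ 2) (k := 1) h.memLp.1
    (by positivity) zero_le_one (by
      rw [one_mul, lpNorm_pow_eq_integral hg.1 2 (by norm_num) (by norm_num), e 4, e 6]
      exact hp.integral_pow_six_le hu hg)
  rwa [Real.one_rpow, mul_one, ← Real.rpow_natCast, ← Real.rpow_mul lpNorm_nonneg,
    show ((2 : ℕ) : ℝ) * (1 / 18) = 1 / 9 by norm_num] at h1

end GNTorus

/-! ### The extremal profile and optimality of the constant -/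

/-- Integrated over the line, the derivative contributes nothing, which leaves a recursion between
consecutive powers. -/
theorem hasDerivAt_inv_one_add_sq_pow (n : ℕ) (x : ℝ) :
    HasDerivAt (fun x : ℝ => x * ((1 + x ^ 2) ^ (n + 1))⁻¹)
      ((2 * n + 2) * ((1 + x ^ 2) ^ (n + 2))⁻¹ - (2 * n + 1) * ((1 + x ^ 2) ^ (n + 1))⁻¹) x := by
  have hp : (0 : ℝ) < 1 + x ^ 2 := by positivity
  have h1 : HasDerivAt (fun x : ℝ => 1 + x ^ 2) (2 * x) x := by
    simpa using (hasDerivAt_pow 2 x).const_add 1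
  have h2 := (hasDerivAt_id x).mul ((h1.pow (n + 1)).inv (pow_pos hp _).ne')
  refine HasDerivAt.congr_deriv h2 ?_
  simp only [id, Pi.inv_apply, Pi.pow_apply, Nat.add_sub_cancel]
  push_cast
  field_simp
  ring

theorem integrable_inv_one_add_sq_pow (n : ℕ) :
    Integrable (fun x : ℝ => ((1 + x ^ 2) ^ (n + 1))⁻¹) volume := by
  refine integrable_inv_one_add_sq.mono' ?_ (.of_forall fun x => ?_)
  · exact (Continuous.inv₀ (by fun_prop) fun x => by positivity).aestronglyMeasurable
  · rw [Real.norm_of_nonneg (by positivity)]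
    refine inv_anti₀ (by positivity) (le_self_pow₀ (by nlinarith [sq_nonneg x]) (by omega))

theorem tendsto_mul_inv_one_add_sq_pow (n : ℕ) :
    Tendsto (fun x : ℝ => x * ((1 + x ^ 2) ^ (n + 1))⁻¹) (cocompact ℝ) (𝓝 0) := by
  have h0 : Tendsto (fun x : ℝ => |x|⁻¹) (cocompact ℝ) (𝓝 0) :=
    tendsto_inv_atTop_zero.comp (tendsto_norm_cocompact_atTop (E := ℝ))
  refine squeeze_zero_norm (fun x => ?_) h0
  have hp : (0 : ℝ) < 1 + x ^ 2 := by positivity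
  rw [norm_mul, Real.norm_eq_abs, Real.norm_of_nonneg (by positivity)]
  rcases (abs_nonneg x).eq_or_lt with hx | hx
  · rw [← hx]; simp
  · have h1 : 1 + x ^ 2 ≤ (1 + x ^ 2) ^ (n + 1) :=
      le_self_pow₀ (by nlinarith [sq_nonneg x]) (by omega)
    have h2 : |x| ^ 2 ≤ (1 + x ^ 2) ^ (n + 1) := by rw [sq_abs]; linarith
    calc |x| * ((1 + x ^ 2) ^ (n + 1))⁻¹ ≤ |x| * (|x| ^ 2)⁻¹ := by gcongr
      _ = |x|⁻¹ := by field_simp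

theorem integral_inv_one_add_sq_pow_succ (n : ℕ) :
    ∫ x : ℝ, ((1 + x ^ 2) ^ (n + 2))⁻¹ =
      ((2 * n + 1) / (2 * n + 2) : ℝ) * ∫ x : ℝ, ((1 + x ^ 2) ^ (n + 1))⁻¹ := by
  have h := integral_of_hasDerivAt_of_tendsto (hasDerivAt_inv_one_add_sq_pow n)
    (((integrable_inv_one_add_sq_pow (n + 1)).const_mul _).sub
      ((integrable_inv_one_add_sq_pow n).const_mul _))
    ((tendsto_mul_inv_one_add_sq_pow n).mono_left atBot_le_cocompact)
    ((tendsto_mul_inv_one_add_sq_pow n).mono_left atTop_le_cocompact)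
  rw [integral_sub ((integrable_inv_one_add_sq_pow (n + 1)).const_mul _)
    ((integrable_inv_one_add_sq_pow n).const_mul _), integral_const_mul, integral_const_mul] at h
  have : (0 : ℝ) < 2 * n + 2 := by positivity
  rw [div_mul_eq_mul_div, eq_div_iff this.ne']
  linarith

theorem integral_inv_one_add_sq_pow_two : ∫ x : ℝ, ((1 + x ^ 2) ^ 2)⁻¹ = Real.pi / 2 := by
  have h := integral_inv_one_add_sq_pow_succ 0
  simp only [zero_add, pow_one, integral_univ_inv_one_add_sq] at h
  rw [h]; norm_num; ring

theorem integral_inv_one_add_sq_pow_three :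
    ∫ x : ℝ, ((1 + x ^ 2) ^ 3)⁻¹ = 3 * Real.pi / 8 := by
  have h := integral_inv_one_add_sq_pow_succ 1
  simp only [Nat.reduceAdd, integral_inv_one_add_sq_pow_two] at h
  rw [h]; norm_num; ring

namespace GNTorus

/-- The extremal profile `(1 + x²)^{-1/2}`. -/
noncomputable def extremal (x : ℝ) : ℂ := ((√(1 + x ^ 2))⁻¹ : ℝ)

/-- The derivative `-x (1 + x²)^{-3/2}` of the extremal profile. -/
noncomputable def extremalDeriv (x : ℝ) : ℂ := (-(x * (√(1 + x ^ 2))⁻¹ ^ 3) : ℝ)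

theorem hasDerivAt_extremal (x : ℝ) : HasDerivAt extremal (extremalDeriv x) x := by
  refine HasDerivAt.ofReal_comp ?_
  have hp : (0 : ℝ) < 1 + x ^ 2 := by positivity
  have h1 : HasDerivAt (fun x : ℝ => 1 + x ^ 2) (2 * x) x := by
    simpa using (hasDerivAt_pow 2 x).const_add 1
  have h2 := (h1.sqrt hp.ne').inv (Real.sqrt_pos.2 hp).ne'
  refine HasDerivAt.congr_deriv h2 ?_
  have := (Real.sqrt_pos.2 hp).ne'
  field_simp

theorem continuous_extremalDeriv : Continuous extremalDeriv := by
  refine Complex.continuous_ofReal.comp (continuous_id.mul (Continuous.pow ?_ 3)).neg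
  exact Continuous.inv₀ (by fun_prop) fun x => (Real.sqrt_pos.2 (by positivity)).ne'

theorem contDiff_extremal : ContDiff ℝ 1 extremal := by
  rw [contDiff_one_iff_deriv]
  refine ⟨fun x => (hasDerivAt_extremal x).differentiableAt, ?_⟩
  rw [show deriv extremal = extremalDeriv from funext fun x => (hasDerivAt_extremal x).deriv]
  exact continuous_extremalDeriv

theorem norm_extremal_pow (x : ℝ) (n : ℕ) : ‖extremal x‖ ^ (2 * n) = ((1 + x ^ 2) ^ n)⁻¹ := by
  rw [extremal, Complex.norm_real, Real.norm_of_nonneg (by positivity), inv_pow, pow_mul,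
    Real.sq_sqrt (by positivity)]

theorem norm_extremalDeriv_sq (x : ℝ) :
    ‖extremalDeriv x‖ ^ 2 = ((1 + x ^ 2) ^ 2)⁻¹ - ((1 + x ^ 2) ^ 3)⁻¹ := by
  have hp : (0 : ℝ) < 1 + x ^ 2 := by positivity
  rw [extremalDeriv, Complex.norm_real, Real.norm_eq_abs, sq_abs, neg_sq, mul_pow, ← pow_mul,
    show 3 * 2 = 2 * 3 from rfl, inv_pow, pow_mul, Real.sq_sqrt hp.le]
  field_simp
  ring

theorem isH1Line_extremal : IsH1Line extremal extremalDeriv where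
  memLp := memLp_of_integrable_norm_pow contDiff_extremal.continuous.aestronglyMeasurable
    two_ne_zero (by norm_num) ((integrable_inv_one_add_sq_pow 0).congr
      (.of_forall fun x => (norm_extremal_pow x 1).symm))
  memLp_deriv := memLp_of_integrable_norm_pow continuous_extremalDeriv.aestronglyMeasurable
    two_ne_zero (by norm_num)
      (((integrable_inv_one_add_sq_pow 1).sub (integrable_inv_one_add_sq_pow 2)).congr
        (.of_forall fun x => (norm_extremalDeriv_sq x).symm))
  weak_deriv φ h1 h2 := by
    have h := IsPrimitive.of_contDiff contDiff_extremal
    rw [show deriv extremal = extremalDeriv from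
      funext fun x => (hasDerivAt_extremal x).deriv] at h
    exact h.integral_mul_deriv_of_hasCompactSupport (h1.of_le (by simp)) h2

theorem CGN_le {C : ℝ} (hC : C ∈ gagliardoNirenbergConstants) : CGN ≤ C := by
  obtain ⟨-, -, h⟩ := hC _ _ isH1Line_extremal
  have hpi := Real.pi_pos
  have m1 := isH1Line_extremal.memLp.1
  have m2 := isH1Line_extremal.memLp_deriv.1
  have n6 := lpNorm_pow_eq_integral m1 6 (p := 6) (by norm_num) (by norm_num)
  have n4 := lpNorm_pow_eq_integral m1 4 (p := 4) (by norm_num) (by norm_num)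
  have n2 := lpNorm_pow_eq_integral m2 2 (p := 2) (by norm_num) (by norm_num)
  simp only [show 6 = 2 * 3 from rfl, norm_extremal_pow, integral_inv_one_add_sq_pow_three] at n6
  simp only [show 4 = 2 * 2 from rfl, norm_extremal_pow, integral_inv_one_add_sq_pow_two] at n4
  simp only [norm_extremalDeriv_sq] at n2
  rw [integral_sub (integrable_inv_one_add_sq_pow 1) (integrable_inv_one_add_sq_pow 2),
    integral_inv_one_add_sq_pow_two, integral_inv_one_add_sq_pow_three] at n2
  norm_num only at n6 n4
  have p2 : 0 ≤ lpNorm extremalDeriv 2 volume := lpNorm_nonneg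
  have p4 : 0 ≤ lpNorm extremal 4 volume := lpNorm_nonneg
  have p6 : 0 ≤ lpNorm extremal 6 volume := lpNorm_nonneg
  set x := lpNorm extremal 6 volume
  set y := lpNorm extremalDeriv 2 volume
  set z := lpNorm extremal 4 volume
  have e : ∀ (y : ℝ) (r : ℝ) (n : ℕ), 0 ≤ y → r * 18 = n → (y ^ r) ^ 18 = y ^ n := by
    intro y r n hy hr
    rw [← Real.rpow_natCast, ← Real.rpow_mul hy]
    push_cast
    rw [hr, Real.rpow_natCast]
  -- The profile has `∫|u'|² = π/2 - 3π/8 = π/8` and `∫|u|⁴ = π/2`, and `(π/8)(π/2)⁴ = π⁵/128`.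
  have h18 : (y ^ (1 / 9 : ℝ) * z ^ (8 / 9 : ℝ)) ^ 18 = Real.pi ^ 5 / 128 := by
    rw [mul_pow, e y _ 2 p2 (by norm_num), e z _ 16 p4 (by norm_num), n2,
      show 16 = 4 * 4 from rfl, pow_mul, n4]
    ring
  have hq0 : 0 ≤ y ^ (1 / 9 : ℝ) * z ^ (8 / 9 : ℝ) := by positivity
  set q := y ^ (1 / 9 : ℝ) * z ^ (8 / 9 : ℝ) with hq
  have hqp : 0 < q := by
    rcases hq0.eq_or_lt with h0 | h0
    · rw [← h0] at h18
      have : 0 < Real.pi ^ 5 / 128 := by positivity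
      norm_num at h18
      linarith
    · exact h0
  have hx : x = CGN * q := by
    refine (pow_left_inj₀ p6 (mul_nonneg CGN_nonneg hq0) (n := 18) (by norm_num)).1 ?_
    rw [mul_pow, CGN_pow, h18, show 18 = 6 * 3 from rfl, pow_mul, n6]
    field_simp
    ring
  rw [mul_assoc, ← hq, hx] at h
  exact le_of_mul_le_mul_right h hqp

theorem isLeast_CGN : IsLeast gagliardoNirenbergConstants CGN :=
  ⟨CGN_mem, fun _ hC => CGN_le hC⟩

end GNTorus

/-! ### Closed loops and the linear cut-off -/

namespace IsPrimitive

variable {u g : ℝ → ℂ}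

/-- The energy inequality along the two arcs joining two points of a closed loop. -/
theorem four_action_le_of_loop (h : IsPrimitive u g) {L p r m : ℝ} (hp : 0 ≤ p) (hpr : p ≤ r)
    (hr : r ≤ L) (hloop : u L = u 0)
    (hg : IntervalIntegrable (fun x => ‖g x‖ ^ 2) volume 0 L)
    (hm : ∀ x ∈ Icc 0 L, ‖u x‖ ≤ m) {l : ℝ} (hl : 0 ≤ l) :
    4 * l * |profileAction m ‖u r‖ - profileAction m ‖u p‖| ≤
      (∫ x in (0 : ℝ)..L, ‖g x‖ ^ 2) + l ^ 2 * (m ^ 2 * (∫ x in (0 : ℝ)..L, ‖u x‖ ^ 4) -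
        ∫ x in (0 : ℝ)..L, ‖u x‖ ^ 6) := by
  have hc := h.continuous
  have hi : ∀ n : ℕ, ∀ x y, IntervalIntegrable (fun x => ‖u x‖ ^ n) volume x y := fun n x y =>
    (by fun_prop : Continuous fun x => ‖u x‖ ^ n).intervalIntegrable _ _
  have hgi : ∀ x y, 0 ≤ x → x ≤ y → y ≤ L →
      IntervalIntegrable (fun x => ‖g x‖ ^ 2) volume x y := fun x y h0 hxy hy =>
    hg.mono_set (by
      rw [uIcc_of_le hxy, uIcc_of_le (h0.trans (hxy.trans hy))]
      exact Icc_subset_Icc h0 hy)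
  have g1 := hgi 0 p le_rfl hp (hpr.trans hr)
  have g2 := hgi p r hp hpr hr
  have g3 := hgi r L (hp.trans hpr) hr le_rfl
  have h1 := h.action_le hp g1 (fun x hx => hm x ⟨hx.1, hx.2.trans (hpr.trans hr)⟩) hl
  have h2 := h.action_le hpr g2 (fun x hx => hm x ⟨hp.trans hx.1, hx.2.trans hr⟩) hl
  have h3 := h.action_le hr g3 (fun x hx => hm x ⟨(hp.trans hpr).trans hx.1, hx.2⟩) hl
  rw [← intervalIntegral.integral_add_adjacent_intervals (g1.trans g2) g3,
    ← intervalIntegral.integral_add_adjacent_intervals g1 g2,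
    ← intervalIntegral.integral_add_adjacent_intervals (hi 4 0 r) (hi 4 r L),
    ← intervalIntegral.integral_add_adjacent_intervals (hi 4 0 p) (hi 4 p r),
    ← intervalIntegral.integral_add_adjacent_intervals (hi 6 0 r) (hi 6 r L),
    ← intervalIntegral.integral_add_adjacent_intervals (hi 6 0 p) (hi 6 p r)]
  -- The pieces `[0, p]` and `[r, L]` join at `u L = u 0` into the second arc, which carries the
  -- same variation as `[p, r]`.
  have htri : |profileAction m ‖u r‖ - profileAction m ‖u p‖| ≤
      |profileAction m ‖u p‖ - profileAction m ‖u 0‖| +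
        |profileAction m ‖u L‖ - profileAction m ‖u r‖| := by
    rw [hloop, abs_sub_comm (profileAction m ‖u p‖),
      abs_sub_comm (profileAction m ‖u 0‖) (profileAction m ‖u r‖), add_comm]
    exact abs_sub_le _ _ _
  have := mul_le_mul_of_nonneg_left htri (by positivity : 0 ≤ 2 * l)
  linarith

end IsPrimitive

/-- The energy inequality for the affine cut-off on an interval of length `δ`. -/
theorem two_mul_profileAction_le {δ s m l : ℝ} (hδ : 0 < δ) (hs : 0 ≤ s) (hsm : s ≤ m)
    (hl : 0 ≤ l) :
    2 * l * profileAction m s ≤ s ^ 2 / δ + l ^ 2 * (m ^ 2 * (s ^ 4 * δ / 5)) := by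
  have hv : ContDiff ℝ 1 fun x : ℝ => ((s / δ * x : ℝ) : ℂ) :=
    Complex.ofRealCLM.contDiff.comp (contDiff_const.mul contDiff_id)
  have hd : deriv (fun x : ℝ => ((s / δ * x : ℝ) : ℂ)) = fun _ => ((s / δ : ℝ) : ℂ) := by
    funext x
    refine (HasDerivAt.ofReal_comp ?_).deriv
    simpa using (hasDerivAt_id x).const_mul (s / δ)
  have hp := IsPrimitive.of_contDiff hv
  rw [hd] at hp
  have hn : ∀ x, 0 ≤ x → ‖((s / δ * x : ℝ) : ℂ)‖ = s / δ * x := fun x hx => by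
    rw [Complex.norm_real, Real.norm_of_nonneg (by positivity)]
  have h := hp.action_le hδ.le (m := m) (by simp) (fun x hx => by
    rw [hn x hx.1]
    refine le_trans ?_ hsm
    rw [div_mul_eq_mul_div, div_le_iff₀ hδ]
    exact mul_le_mul_of_nonneg_left hx.2 hs) hl
  have hpw : ∀ n : ℕ, ∫ x in (0 : ℝ)..δ, ‖((s / δ * x : ℝ) : ℂ)‖ ^ n =
      (s / δ) ^ n * (δ ^ (n + 1) / (n + 1)) := fun n => by
    rw [intervalIntegral.integral_congr (g := fun x => (s / δ) ^ n * x ^ n)]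
    · rw [intervalIntegral.integral_const_mul, integral_pow]
      simp
    · intro x hx
      rw [uIcc_of_le hδ.le] at hx
      simp only [hn x hx.1, mul_pow]
  rw [hpw, hpw, hn δ hδ.le, hn 0 le_rfl, mul_zero, profileAction_zero, sub_zero,
    div_mul_cancel₀ _ hδ.ne', intervalIntegral.integral_const, Complex.norm_real,
    Real.norm_of_nonneg (by positivity)] at h
  refine ((mul_le_mul_of_nonneg_left (le_abs_self _) (by positivity)).trans h).trans ?_
  have e1 : (δ - 0) • (s / δ) ^ 2 = s ^ 2 / δ := by
    rw [smul_eq_mul]; field_simp; ring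
  have e2 : (s / δ) ^ 4 * (δ ^ (4 + 1) / (((4 : ℕ) : ℝ) + 1)) = s ^ 4 * δ / 5 := by
    push_cast; field_simp; norm_num
  rw [e1, e2]
  -- The sixth-power term of the ramp has a favourable sign and is discarded.
  have : 0 ≤ (s / δ) ^ 6 * (δ ^ (6 + 1) / (((6 : ℕ) : ℝ) + 1)) := by positivity
  gcongr
  linarith

/-- The inequality on a circle of length `L`, for primitives. -/
theorem IsPrimitive.integral_pow_six_le_of_loop {u g : ℝ → ℂ} (h : IsPrimitive u g) {L δ q : ℝ}
    (hL : 0 < L) (hδ : 0 < δ) (hloop : u L = u 0)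
    (hg : IntervalIntegrable (fun x => ‖g x‖ ^ 2) volume 0 L)
    (hq : q ^ 4 = ∫ x in (0 : ℝ)..L, ‖u x‖ ^ 4) :
    (∫ x in (0 : ℝ)..L, ‖u x‖ ^ 6) ^ 3 ≤
      27 / (4 * Real.pi ^ 2) *
        ((∫ x in (0 : ℝ)..L, ‖g x‖ ^ 2) + 2 / (δ * L ^ (1 / 2 : ℝ)) * q ^ 2) *
        ((1 + 2 * δ / (5 * L)) * ∫ x in (0 : ℝ)..L, ‖u x‖ ^ 4) ^ 4 := by
  have hc := h.continuous
  have hi : ∀ n : ℕ, ∀ x y, IntervalIntegrable (fun x => ‖u x‖ ^ n) volume x y := fun n x y =>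
    (by fun_prop : Continuous fun x => ‖u x‖ ^ n).intervalIntegrable _ _
  have hne : (Icc 0 L).Nonempty := nonempty_Icc.2 hL.le
  obtain ⟨p, hp, hpmin⟩ := isCompact_Icc.exists_isMinOn hne (hc.norm.continuousOn (s := Icc 0 L))
  obtain ⟨r, hr, hrmax⟩ := isCompact_Icc.exists_isMaxOn hne (hc.norm.continuousOn (s := Icc 0 L))
  set s := ‖u p‖ with hs
  set m := ‖u r‖ with hm
  have hs0 : 0 ≤ s := norm_nonneg _
  have hm0 : 0 ≤ m := norm_nonneg _
  have hmin : ∀ x ∈ Icc 0 L, s ≤ ‖u x‖ := fun x hx => hpmin hx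
  have hmax : ∀ x ∈ Icc 0 L, ‖u x‖ ≤ m := fun x hx => hrmax hx
  have hsm : s ≤ m := hmin r hr
  have hA : 0 ≤ ∫ x in (0 : ℝ)..L, ‖g x‖ ^ 2 :=
    intervalIntegral.integral_nonneg hL.le fun x _ => by positivity
  have hG : 0 ≤ ∫ x in (0 : ℝ)..L, ‖u x‖ ^ 6 :=
    intervalIntegral.integral_nonneg hL.le fun x _ => by positivity
  have hGB : ∫ x in (0 : ℝ)..L, ‖u x‖ ^ 6 ≤ m ^ 2 * ∫ x in (0 : ℝ)..L, ‖u x‖ ^ 4 := by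
    rw [← intervalIntegral.integral_const_mul]
    refine intervalIntegral.integral_mono_on hL.le (hi 6 0 L) ((hi 4 0 L).const_mul _)
      fun x hx => ?_
    have : ‖u x‖ ^ 2 ≤ m ^ 2 := pow_le_pow_left₀ (norm_nonneg _) (hmax x hx) 2
    nlinarith [pow_nonneg (norm_nonneg (u x)) 4]
  have hsB : L * s ^ 4 ≤ ∫ x in (0 : ℝ)..L, ‖u x‖ ^ 4 := by
    have h1 := intervalIntegral.integral_mono_on (μ := volume) hL.le
      (intervalIntegrable_const (c := s ^ 4)) (hi 4 0 L)
      fun x hx => pow_le_pow_left₀ hs0 (hmin x hx) 4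
    simpa using h1
  have hloopE : ∀ l : ℝ, 0 ≤ l → 4 * l * |profileAction m m - profileAction m s| ≤
      (∫ x in (0 : ℝ)..L, ‖g x‖ ^ 2) + l ^ 2 * (m ^ 2 * (∫ x in (0 : ℝ)..L, ‖u x‖ ^ 4) -
        ∫ x in (0 : ℝ)..L, ‖u x‖ ^ 6) := fun l hl => by
    rcases le_total p r with hpr | hpr
    · exact h.four_action_le_of_loop hp.1 hpr hr.2 hloop hg hmax hl
    · rw [abs_sub_comm]
      exact h.four_action_le_of_loop hr.1 hpr hp.2 hloop hg hmax hl
  set A := ∫ x in (0 : ℝ)..L, ‖g x‖ ^ 2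
  set B := ∫ x in (0 : ℝ)..L, ‖u x‖ ^ 4
  set G := ∫ x in (0 : ℝ)..L, ‖u x‖ ^ 6
  have hB : 0 ≤ B := (by positivity : 0 ≤ L * s ^ 4).trans hsB
  -- Square root of `L s⁴ ≤ B = q⁴`; it converts the gradient cost of the ramps into the `L⁴` term.
  have hsq : s ^ 2 * √L ≤ q ^ 2 := by
    refine le_of_pow_le_pow_left₀ two_ne_zero (by positivity) ?_
    rw [mul_pow, Real.sq_sqrt hL.le]
    linarith
  have hsA : 2 * (s ^ 2 / δ) ≤ 2 / (δ * √L) * q ^ 2 := by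
    have hL' : 0 < √L := Real.sqrt_pos.2 hL
    rw [div_mul_eq_mul_div, le_div_iff₀ (by positivity)]
    calc 2 * (s ^ 2 / δ) * (δ * √L) = 2 * (s ^ 2 * √L) := by field_simp
      _ ≤ 2 * q ^ 2 := by linarith
  have hsB' : B + 2 * (s ^ 4 * δ / 5) ≤ (1 + 2 * δ / (5 * L)) * B := by
    have : 2 * (s ^ 4 * δ / 5) = 2 * δ / (5 * L) * (L * s ^ 4) := by field_simp
    rw [this, add_mul, one_mul]
    gcongr
  rw [← Real.sqrt_eq_rpow]
  -- The loop inequality plus twice the ramp inequality: the `H(s)` terms cancel, leaving the line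
  -- estimate with enlarged `A` and `B`.
  refine pow_three_le_of_forall_energy (m := m) (by positivity) hG hm0 (hGB.trans ?_) fun l hl => ?_
  · refine mul_le_mul_of_nonneg_left (le_trans ?_ hsB') (by positivity)
    have : 0 ≤ s ^ 4 * δ / 5 := by positivity
    linarith
  have h1 := (mul_le_mul_of_nonneg_left (le_abs_self _) (by positivity)).trans (hloopE l hl.le)
  have h2 := two_mul_profileAction_le hδ hs0 hsm hl.le
  rw [profileAction_self hm0] at h1
  have h3 := mul_le_mul_of_nonneg_left hsB' (by positivity : 0 ≤ l ^ 2 * m ^ 2)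
  linarith

/-! ### Weak derivatives on the circle and conclusion -/

namespace GNTorus

/-- Testing against characters shows that `f` and a suitable primitive of `g` have the same Fourier
coefficients, so Parseval makes them equal a.e. -/
theorem IsH1Circle.exists_isPrimitive {L : ℝ} [hL : Fact (0 < L)] {f g : AddCircle L → ℂ}
    (h : IsH1Circle f g) :
    ∃ u : ℝ → ℂ, IsPrimitive u (fun x => g (x : AddCircle L)) ∧ u L = u 0 ∧
      (fun x : ℝ => f (x : AddCircle L)) =ᵐ[volume.restrict (Ioc 0 L)] u := by
  have hL0 : 0 < L := hL.out
  have hmp : MeasurePreserving ((↑) : ℝ → AddCircle L) (volume.restrict (Ioc 0 L)) volume := by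
    simpa using AddCircle.measurePreserving_mk L 0
  have hF2 : MemLp (fun x : ℝ => f (x : AddCircle L)) 2 (volume.restrict (Ioc 0 L)) :=
    h.memLp.comp_measurePreserving hmp
  have hG2 : MemLp (fun x : ℝ => g (x : AddCircle L)) 2 (volume.restrict (Ioc 0 L)) :=
    h.memLp_deriv.comp_measurePreserving hmp
  have hFi : IntervalIntegrable (fun x : ℝ => f (x : AddCircle L)) volume 0 L :=
    (intervalIntegrable_iff_integrableOn_Ioc_of_le hL0.le).2 (hF2.integrable (by norm_num))
  have hGi0 : IntervalIntegrable (fun x : ℝ => g (x : AddCircle L)) volume 0 L :=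
    (intervalIntegrable_iff_integrableOn_Ioc_of_le hL0.le).2 (hG2.integrable (by norm_num))
  have hper : Function.Periodic (fun x : ℝ => g (x : AddCircle L)) L := fun x => by simp
  have hGl : LocallyIntegrable (fun x : ℝ => g (x : AddCircle L)) volume := fun x =>
    ⟨Ioc (x - 1) (x + 1), Ioc_mem_nhds (by linarith) (by linarith),
      (hper.intervalIntegrable₀ hL0.ne' hGi0 (x - 1) (x + 1)).1⟩
  have hint : ∀ F : AddCircle L → ℂ, ∫ x in (0 : ℝ)..L, F (x : AddCircle L) = ∫ x, F x :=
    fun F => by simpa using AddCircle.intervalIntegral_preimage L 0 F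
  have hG0 : ∫ x in (0 : ℝ)..L, g (x : AddCircle L) = 0 := by
    -- The constant test function shows that `g` has mean zero, which makes its primitive close up.
    have h0 := h.weak_deriv (fun _ => 1) (fun _ => 0) contDiff_const
      (fun x => hasDerivAt_const x (1 : ℂ))
    rw [hint]
    simpa using h0.symm
  have hu0 := hGl.isPrimitive 0
  set u₀ : ℝ → ℂ := fun x => 0 + ∫ t in (0 : ℝ)..x, g (t : AddCircle L) with hu₀
  -- The constant is chosen to annihilate the zeroth Fourier coefficient of `f - u`, which the weak
  -- derivative cannot detect.
  set c : ℂ := (L : ℂ)⁻¹ * ∫ x in (0 : ℝ)..L, (f (x : AddCircle L) - u₀ x) with hcdef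
  have hu := hGl.isPrimitive c
  set u : ℝ → ℂ := fun x => c + ∫ t in (0 : ℝ)..x, g (t : AddCircle L) with hudef
  have huu : ∀ x, u x = c + u₀ x := fun x => by simp [hudef, hu₀]
  have hloop : u L = u 0 := by simp [hudef, hG0]
  have hLc : (L : ℂ) ≠ 0 := by exact_mod_cast hL0.ne'
  refine ⟨u, hu, hloop, ?_⟩
  set w : ℝ → ℂ := fun x => f (x : AddCircle L) - u x with hw
  have hui : IntervalIntegrable u volume 0 L := hu.continuous.intervalIntegrable _ _
  have hu2 : MemLp u 2 (volume.restrict (Ioc 0 L)) := by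
    obtain ⟨C, hC⟩ := (isCompact_Icc (a := (0 : ℝ)) (b := L)).exists_bound_of_continuousOn
      hu.continuous.continuousOn
    exact MemLp.of_bound hu.continuous.aestronglyMeasurable C
      ((ae_restrict_iff' measurableSet_Ioc).2 (.of_forall fun x hx => hC x (Ioc_subset_Icc_self hx)))
  have hw2 : MemLp w 2 (volume.restrict (Ioc 0 L)) := hF2.sub hu2
  have hcoef : ∀ n : ℤ, ∫ x in (0 : ℝ)..L, w x * fourier n (x : AddCircle L) = 0 := by
    intro n
    rcases eq_or_ne n 0 with rfl | hn
    · simp only [fourier_zero, mul_one, hw, huu]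
      have e : ∀ x : ℝ, f (x : AddCircle L) - (c + u₀ x) = (f (x : AddCircle L) - u₀ x) - c :=
        fun x => by ring
      simp only [e]
      rw [intervalIntegral.integral_sub
        (hFi.sub (hu0.continuous.intervalIntegrable _ _)) intervalIntegrable_const,
        intervalIntegral.integral_const, sub_zero, Complex.real_smul, hcdef,
        mul_inv_cancel_left₀ hLc, sub_self]
    -- A character is an eigenfunction of differentiation with eigenvalue `κ ≠ 0`, so the identical
    -- integrations by parts for `f` and `u` can be divided by `κ`.
    · set κ : ℂ := 2 * Real.pi * Complex.I * n / L with hκ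
      have hκ0 : κ ≠ 0 := by
        refine div_ne_zero (mul_ne_zero (mul_ne_zero (mul_ne_zero two_ne_zero ?_)
          Complex.I_ne_zero) ?_) hLc
        · exact_mod_cast Real.pi_ne_zero
        · exact_mod_cast hn
      have hder : ∀ x : ℝ, HasDerivAt (fun y : ℝ => fourier n (y : AddCircle L))
          (κ * fourier n (x : AddCircle L)) x := hasDerivAt_fourier L n
      have hsm : ContDiff ℝ ∞ fun x : ℝ => fourier n (x : AddCircle L) := by
        simp only [fourier_coe_apply]
        refine ContDiff.cexp ?_
        exact (contDiff_const.mul Complex.ofRealCLM.contDiff).div_const _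
      have hwk := h.weak_deriv (fun x => fourier n x) (fun x => κ * fourier n x) hsm hder
      rw [← hint, ← hint] at hwk
      have hibp := hu.integral_mul_deriv (hsm.of_le (by simp)) 0 L
      simp only [(hder _).deriv] at hibp
      have hend : fourier n ((L : ℝ) : AddCircle L) = fourier n ((0 : ℝ) : AddCircle L) := by
        rw [AddCircle.coe_period, QuotientAddGroup.mk_zero]
      rw [hloop, hend, sub_self, zero_sub] at hibp
      have hec : Continuous fun x : ℝ => κ * fourier n (x : AddCircle L) :=
        continuous_const.mul hsm.continuous
      have hz : ∫ x in (0 : ℝ)..L, w x * (κ * fourier n (x : AddCircle L)) = 0 := by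
        simp only [hw, sub_mul]
        rw [intervalIntegral.integral_sub (hFi.mul_continuousOn hec.continuousOn)
          (hui.mul_continuousOn hec.continuousOn), hwk, hibp, sub_self]
      have e : ∀ x : ℝ, w x * (κ * fourier n (x : AddCircle L)) =
          κ * (w x * fourier n (x : AddCircle L)) := fun x => by ring
      simp only [e] at hz
      rw [intervalIntegral.integral_const_mul] at hz
      exact (mul_eq_zero.1 hz).resolve_left hκ0
  have hsum := hasSum_sq_fourierCoeffOn hL0 hw2
  have hzero : ∀ n : ℤ, fourierCoeffOn hL0 w n = 0 := fun n => by
    rw [fourierCoeffOn_eq_integral]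
    have := hcoef (-n)
    simp only [fourier_coe_apply, sub_zero, smul_eq_mul] at this ⊢
    simp only [mul_comm (Complex.exp _)]
    rw [this, smul_zero]
  simp only [hzero, norm_zero, ne_eq, OfNat.ofNat_ne_zero, not_false_eq_true, zero_pow] at hsum
  have hI := hsum.unique hasSum_zero
  rw [smul_eq_mul, sub_zero, mul_eq_zero, intervalIntegral.integral_of_le hL0.le] at hI
  have hI' := hI.resolve_left (inv_ne_zero hL0.ne')
  rw [integral_eq_zero_iff_of_nonneg (fun x => by positivity)
    (hw2.integrable_norm_pow two_ne_zero)] at hI'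
  filter_upwards [hI'] with x hx
  have : ‖w x‖ = 0 := by simpa using hx
  exact sub_eq_zero.1 (norm_eq_zero.1 this)

theorem circle_inequality (L : ℝ) [hL : Fact (0 < L)] (δ : ℝ) (hδ : 0 < δ)
    (f g : AddCircle L → ℂ) (h : IsH1Circle f g) :
    MemLp f 4 volume ∧ MemLp f 6 volume ∧
      lpNorm f 6 volume ≤ CGN * (1 + 2 * δ / (5 * L)) ^ (2 / 9 : ℝ) *
        (lpNorm g 2 volume ^ 2 + 2 / (δ * L ^ (1 / 2 : ℝ)) * lpNorm f 4 volume ^ 2) ^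
          (1 / 18 : ℝ) * lpNorm f 4 volume ^ (8 / 9 : ℝ) := by
  have hL0 : 0 < L := hL.out
  obtain ⟨u, hu, hloop, hfu⟩ := h.exists_isPrimitive
  have hmp : MeasurePreserving ((↑) : ℝ → AddCircle L) (volume.restrict (Ioc 0 L)) volume := by
    simpa using AddCircle.measurePreserving_mk L 0
  have hint : ∀ F : AddCircle L → ℝ, ∫ x in (0 : ℝ)..L, F (x : AddCircle L) = ∫ x, F x :=
    fun F => by simpa using AddCircle.intervalIntegral_preimage L 0 F
  have hc := hu.continuous
  have hint_pow : ∀ n : ℕ, Integrable (fun x => ‖f x‖ ^ n) volume := fun n => by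
    refine (hmp.integrable_comp (h.memLp.1.norm.pow n)).1 ?_
    have hun : IntegrableOn (fun x => ‖u x‖ ^ n) (Ioc 0 L) volume :=
      ((by fun_prop : Continuous fun x => ‖u x‖ ^ n).intervalIntegrable 0 L).1
    exact hun.congr (hfu.mono fun x hx => by simp only [Function.comp_apply, Pi.pow_apply, hx])
  have e : ∀ n : ℕ, ∫ x, ‖f x‖ ^ n = ∫ x in (0 : ℝ)..L, ‖u x‖ ^ n := fun n => by
    rw [← hint fun x => ‖f x‖ ^ n, intervalIntegral.integral_of_le hL0.le,
      intervalIntegral.integral_of_le hL0.le]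
    exact integral_congr_ae (hfu.mono fun x hx => by simp only [hx])
  have hf := h.memLp.1
  have hg := h.memLp_deriv
  refine ⟨memLp_of_integrable_norm_pow hf (n := 4) (by norm_num) (by norm_num) (hint_pow 4),
    memLp_of_integrable_norm_pow hf (n := 6) (by norm_num) (by norm_num) (hint_pow 6), ?_⟩
  refine lpNorm_six_le hf (by positivity) (by positivity) ?_
  rw [e 4, e 6, lpNorm_pow_eq_integral hg.1 2 (by norm_num) (by norm_num),
    ← hint fun x => ‖g x‖ ^ 2]
  refine hu.integral_pow_six_le_of_loop hL0 hδ hloop ?_ ?_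
  · exact (intervalIntegrable_iff_integrableOn_Ioc_of_le hL0.le).2
      ((hg.comp_measurePreserving hmp).integrable_norm_pow two_ne_zero)
  · rw [lpNorm_pow_eq_integral hf 4 (by norm_num) (by norm_num), e 4]

end GNTorus

theorem lemma1 :
    IsLeast GNTorus.gagliardoNirenbergConstants GNTorus.CGN ∧
    ∀ (L : ℝ) [Fact (0 < L)] (δ : ℝ), 0 < δ →
      ∀ f f' : AddCircle L → ℂ, GNTorus.IsH1Circle f f' →
        MemLp f 4 volume ∧ MemLp f 6 volume ∧
        lpNorm f 6 volume ≤
          GNTorus.CGN * (1 + 2 * δ / (5 * L)) ^ (2 / 9 : ℝ) *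
            (lpNorm f' 2 volume ^ 2 +
              2 / (δ * L ^ (1 / 2 : ℝ)) * lpNorm f 4 volume ^ 2) ^ (1 / 18 : ℝ) *
            lpNorm f 4 volume ^ (8 / 9 : ℝ) :=
  ⟨GNTorus.isLeast_CGN, fun L _ δ hδ f f' h => GNTorus.circle_inequality L δ hδ f f' h⟩
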